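/- Let $\mathbb{T}^d=\mathbb{R}^d/\mathbb{Z}^d$ with normalized Lebesgue measure $\lambda$, let $\mathcal{S}(\mathbb{T}^d)$ be the space of smooth real-valued functions on $\mathbb{T}^d$ with its usual Fréchet topology, and let $\mathcal{S}'(\mathbb{T}^d)$ be its topological dual, equipped with the cylindrical $\sigma$-field (generated by the sets $\{u : (\langle u,\varphi_1\rangle,\dots,\langle u,\varphi_N\rangle)\in B\}$ with $\varphi_1,\dots,\varphi_N\in\mathcal{S}(\mathbb{T}^d)$ and $B\subset\mathbb{R}^N$ Borel). A *periodic compound Poisson white noise* is a measurable map $w$ from a probability space $(\Omega,\mathcal{F},\mathscr{P})$ to $\mathcal{S}'(\mathbb{T}^d)$ such that, for some $c>0$ and some probability measure $P$ on $\mathbb{R}\setminus\{0\}$, $$\mathbb{E}\big[e^{\mathrm{i}\langle w,\varphi\rangle}\big]=\exp\Big(c\int_{\mathbb{T}^d}\int_{\mathbb{R}\setminus\{0\}}\big(e^{\mathrm{i}t\varphi(r)}-1\big)\,P(\mathrm{d}t)\,\lambda(\mathrm{d}r)\Big)\qquad\text{for all }\varphi\in\mathcal{S}(\mathbb{T}^d).$$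 For $\tau\in\mathbb{R}$ and $0<p,q\le\infty$, the Besov space $B^{\tau}_{p,q}(\mathbb{T}^d)$ is the set of all $u\in\mathcal{S}'(\mathbb{T}^d)$ with $$\Big(\sum_{j\ge 0}2^{j\tau q}\Big\|\sum_{k\in\mathbb{Z}^d}\varphi_j(k)\,\langle u,e^{-2\pi\mathrm{i}\langle k,\cdot\rangle}\rangle\,e^{2\pi\mathrm{i}\langle k,\cdot\rangle}\Big\|_{L_p(\mathbb{T}^d)}^{q}\Big)^{1/q}<\infty$$ (with a supremum over $j$ if $q=\infty$), where $\varphi_0\in C^\infty(\mathbb{R}^d)$ is real-valued with $\varphi_0(\xi)=1$ for $|\xi|\le 1$ and $\varphi_0(\xi)=0$ for $|\xi|\ge 3/2$, and $\varphi_j(\xi)=\varphi_0(2^{-j}\xi)-\varphi_0(2^{-j+1}\xi)$ for $j\ge 1$; the space does not depend on the choice of $\varphi_0$. **Proposition 4.3.** Let $w$ be a periodic compound Poisson white noise on $\mathbb{T}^d$. Then for every $\tau\in\mathbb{R}$ and all $0<p,q\le\infty$ with $\tau<d\left(\frac1p-1\right)$ (where $1/\infty=0$), we have $w\in B^{\tau}_{p,q}(\mathbb{T}^d)$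 almost surely. -/

import Mathlib

open MeasureTheory Topology
open scoped ENNReal

namespace PeriodicNoise

/-! ### Smooth functions and generalized functions on the torus `𝕋^d = ℝ^d / ℤ^d` -/

/-- The quotient map `ℝ^d → 𝕋^d = ℝ^d / ℤ^d`. -/
def proj {d : ℕ} (x : Fin d → ℝ) : UnitAddTorus (Fin d) := fun i => (x i : UnitAddCircle)

/-- The space of real-valued functions on `𝕋^d` whose periodic lift to `ℝ^d` is smooth. -/
def smoothSubmodule (d : ℕ) : Submodule ℝ (UnitAddTorus (Fin d) → ℝ) where
  carrier := {φ | ContDiff ℝ (⊤ : ℕ∞) (fun x : Fin d → ℝ => φ (proj x))}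
  add_mem' hf hg := by
    simp only [Set.mem_ofPred_eq] at hf hg ⊢
    exact hf.add hg
  zero_mem' := by
    simp only [Set.mem_ofPred_eq]
    exact contDiff_const
  smul_mem' c _ hf := by
    simp only [Set.mem_ofPred_eq] at hf ⊢
    exact hf.const_smul c

/-- `𝒮(𝕋^d)`, the space of smooth real-valued functions on the torus. A type of its own, so that it
does not inherit the topology of pointwise convergence. -/
def TestFunction (d : ℕ) : Type := smoothSubmodule d

noncomputable instance (d : ℕ) : AddCommGroup (TestFunction d) :=
  inferInstanceAs (AddCommGroup (smoothSubmodule d))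

noncomputable instance (d : ℕ) : Module ℝ (TestFunction d) :=
  inferInstanceAs (Module ℝ (smoothSubmodule d))

instance (d : ℕ) : FunLike (TestFunction d) (UnitAddTorus (Fin d)) ℝ where
  coe φ := φ.1
  coe_injective _ _ h := Subtype.ext h

/-- The periodic lift of a test function to `ℝ^d`. -/
def TestFunction.lift {d : ℕ} (φ : TestFunction d) : (Fin d → ℝ) → ℝ := fun x => φ (proj x)

theorem TestFunction.contDiff_lift {d : ℕ} (φ : TestFunction d) : ContDiff ℝ (⊤ : ℕ∞) φ.lift := φ.2

theorem TestFunction.lift_add {d : ℕ} (φ ψ : TestFunction d) :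
    (φ + ψ).lift = φ.lift + ψ.lift := rfl

theorem TestFunction.lift_smul {d : ℕ} (c : ℝ) (φ : TestFunction d) :
    (c • φ).lift = c • φ.lift := rfl

/-- All derivatives of a smooth periodic function are bounded. -/
theorem TestFunction.bddAbove {d : ℕ} (k : ℕ) (φ : TestFunction d) :
    BddAbove (Set.range fun x => ‖iteratedFDeriv ℝ k φ.lift x‖) := by
  have hcont : Continuous fun x => ‖iteratedFDeriv ℝ k φ.lift x‖ :=
    (φ.contDiff_lift.continuous_iteratedFDeriv (by exact_mod_cast le_top)).norm
  obtain ⟨C, hC⟩ := ((isCompact_Icc (a := (0 : Fin d → ℝ)) (b := 1)).image hcont).bddAbove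
  refine ⟨C, ?_⟩
  rintro _ ⟨x, rfl⟩
  have hper : (fun y => φ.lift (y + fun i => (-⌊x i⌋ : ℝ))) = φ.lift := by
    funext y
    have : proj (y + fun i => (-⌊x i⌋ : ℝ)) = proj y := by
      funext i
      simp only [proj, Pi.add_apply]
      rw [AddCircle.coe_add, ← Int.cast_neg]
      simp
    simp [TestFunction.lift, this]
  have hx := iteratedFDeriv_comp_add_right (𝕜 := ℝ) (f := φ.lift) k (fun i => (-⌊x i⌋ : ℝ)) x
  rw [hper] at hx
  dsimp only
  rw [hx]
  refine hC ⟨_, ⟨fun i => ?_, fun i => ?_⟩, rfl⟩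
  · simpa using Int.floor_le (x i)
  · have := (Int.lt_floor_add_one (x i)).le
    simp only [Pi.add_apply, Pi.one_apply]
    linarith

/-- The norm `sup_x ‖D^k φ(x)‖` of the `k`-th derivative, as a seminorm on `𝒮(𝕋^d)`. -/
noncomputable def derivSeminorm (d : ℕ) (k : ℕ) : Seminorm ℝ (TestFunction d) :=
  Seminorm.of (fun φ => ⨆ x, ‖iteratedFDeriv ℝ k φ.lift x‖)
    (by
      intro φ ψ
      refine ciSup_le fun x => ?_
      rw [TestFunction.lift_add, iteratedFDeriv_add_apply
        (φ.contDiff_lift.of_le (by exact_mod_cast le_top)).contDiffAt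
        (ψ.contDiff_lift.of_le (by exact_mod_cast le_top)).contDiffAt]
      exact (norm_add_le _ _).trans
        (add_le_add (le_ciSup (φ.bddAbove k) x) (le_ciSup (ψ.bddAbove k) x)))
    (by
      intro c φ
      rw [Real.mul_iSup_of_nonneg (norm_nonneg c)]
      refine congrArg _ (funext fun x => ?_)
      rw [TestFunction.lift_smul, iteratedFDeriv_const_smul_apply
        (φ.contDiff_lift.of_le (by exact_mod_cast le_top)).contDiffAt, norm_smul])

/-- The Fréchet topology of `𝒮(𝕋^d)`: uniform convergence of all derivatives. -/
noncomputable instance (d : ℕ) : TopologicalSpace (TestFunction d) :=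
  (SeminormFamily.moduleFilterBasis (𝕜 := ℝ) (derivSeminorm d)).topology

theorem withSeminorms_derivSeminorm (d : ℕ) : WithSeminorms (derivSeminorm d) := ⟨rfl⟩

/-- `𝒮'(𝕋^d)`, the topological dual of `𝒮(𝕋^d)`. -/
abbrev Distribution (d : ℕ) : Type := TestFunction d →L[ℝ] ℝ

/-! ### Generalized periodic processes -/

/-- The cylindrical σ-field of `𝒮'(𝕋^d)`, generated by the cylindrical sets
`{u | (⟨u, φ₁⟩, …, ⟨u, φ_N⟩) ∈ B}` with `B ⊆ ℝ^N` Borel. -/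
instance (d : ℕ) : MeasurableSpace (Distribution d) :=
  MeasurableSpace.generateFrom
    {C | ∃ (N : ℕ) (φ : Fin N → TestFunction d) (B : Set (Fin N → ℝ)),
      MeasurableSet B ∧ C = {u | (fun n => u (φ n)) ∈ B}}

/-- The characteristic functional `φ ↦ ∫ exp(i ⟨u, φ⟩) dμ(u)` of a law `μ` on `𝒮'(𝕋^d)`. -/
noncomputable def charFunctional {d : ℕ} (μ : Measure (Distribution d)) (φ : TestFunction d) : ℂ :=
  ∫ u, Complex.exp (Complex.I * (u φ : ℂ)) ∂μ

/-- `w` is a generalized periodic process on `(Ω, ℙ)` whose law has the characteristic functional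
`exp (c ∫_{𝕋^d} ∫_{ℝ ∖ {0}} (exp (i t φ(r)) - 1) P(dt) λ(dr))`, with `c > 0` and `P` a probability
measure on `ℝ ∖ {0}`, seen as a probability measure on `ℝ` that gives mass zero to `{0}`. Here
`λ = volume` is the Lebesgue measure on `𝕋^d`, of total mass one. -/
def IsCompoundPoissonNoise {d : ℕ} {Ω : Type*} [MeasurableSpace Ω] (ℙ : Measure Ω)
    (w : Ω → Distribution d) : Prop :=
  Measurable w ∧
  ∃ (c : ℝ) (P : Measure ℝ), 0 < c ∧ IsProbabilityMeasure P ∧ P {0} = 0 ∧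
    ∀ φ : TestFunction d, charFunctional (ℙ.map w) φ =
      Complex.exp (c * ∫ r : UnitAddTorus (Fin d), ∫ t : ℝ,
        (Complex.exp (Complex.I * t * (φ r : ℂ)) - 1) ∂P ∂volume)

/-! ### Besov spaces -/

theorem contDiff_mFourier {d : ℕ} (k : Fin d → ℤ) :
    ContDiff ℝ (⊤ : ℕ∞) (fun x : Fin d → ℝ => UnitAddTorus.mFourier k (proj x)) := by
  have : (fun x : Fin d → ℝ => UnitAddTorus.mFourier k (proj x)) =
      fun x => ∏ i, Complex.exp (2 * Real.pi * Complex.I * (k i : ℂ) * (x i : ℂ)) := by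
    funext x
    simp [UnitAddTorus.mFourier, proj]
  rw [this]
  refine contDiff_prod fun i _ => ContDiff.cexp (contDiff_const.mul ?_)
  exact Complex.ofRealCLM.contDiff.comp (contDiff_apply ℝ ℝ i)

/-- The test function `x ↦ Re exp(2πi ⟨k, x⟩) = cos(2π ⟨k, x⟩)`. -/
noncomputable def cosTest {d : ℕ} (k : Fin d → ℤ) : TestFunction d :=
  ⟨fun x => (UnitAddTorus.mFourier k x).re,
    Complex.reCLM.contDiff.comp (contDiff_mFourier k)⟩

/-- The test function `x ↦ Im exp(2πi ⟨k, x⟩) = sin(2π ⟨k, x⟩)`. -/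
noncomputable def sinTest {d : ℕ} (k : Fin d → ℤ) : TestFunction d :=
  ⟨fun x => (UnitAddTorus.mFourier k x).im,
    Complex.imCLM.contDiff.comp (contDiff_mFourier k)⟩

/-- The Fourier coefficient `⟨u, exp(-2πi ⟨k, ·⟩)⟩`, where `u` is extended to complex-valued test
functions by complex linearity. -/
noncomputable def fourierCoeff {d : ℕ} (u : Distribution d) (k : Fin d → ℤ) : ℂ :=
  (u (cosTest (-k)) : ℂ) + Complex.I * (u (sinTest (-k)) : ℂ)

/-- The generator `χ = φ₀` of a smooth dyadic resolution of unity on `ℝ^d`. -/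
structure IsDyadicCutoff {d : ℕ} (χ : EuclideanSpace ℝ (Fin d) → ℝ) : Prop where
  contDiff : ContDiff ℝ (⊤ : ℕ∞) χ
  eq_one : ∀ ξ, ‖ξ‖ ≤ 1 → χ ξ = 1
  eq_zero : ∀ ξ, 3 / 2 ≤ ‖ξ‖ → χ ξ = 0

/-- The dyadic resolution of unity generated by `χ`: `φ₀ = χ` and
`φ_j(ξ) = χ(2^{-j} ξ) - χ(2^{-j+1} ξ)` for `j ≥ 1`. -/
noncomputable def dyadicPiece {d : ℕ} (χ : EuclideanSpace ℝ (Fin d) → ℝ) :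
    ℕ → EuclideanSpace ℝ (Fin d) → ℝ
  | 0, ξ => χ ξ
  | j + 1, ξ => χ (((2 : ℝ) ^ (j + 1))⁻¹ • ξ) - χ (((2 : ℝ) ^ j)⁻¹ • ξ)

/-- The `j`-th dyadic block `∑_k φ_j(k) ⟨u, exp(-2πi ⟨k, ·⟩)⟩ exp(2πi ⟨k, x⟩)` of `u`. It is a
trigonometric polynomial: if `χ` is a dyadic cutoff, then only finitely many terms are nonzero. -/
noncomputable def dyadicBlock {d : ℕ} (χ : EuclideanSpace ℝ (Fin d) → ℝ) (u : Distribution d)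
    (j : ℕ) (x : UnitAddTorus (Fin d)) : ℂ :=
  ∑' k : Fin d → ℤ, (dyadicPiece χ j (WithLp.toLp 2 fun i => (k i : ℝ)) : ℂ) *
    fourierCoeff u k * UnitAddTorus.mFourier k x

/-- The Besov (quasi-)norm `(∑_j (2^{jτ} ‖Δ_j u‖_{L_p(𝕋^d)})^q)^{1/q}` (a supremum over `j` if
`q = ∞`, an essential supremum over `𝕋^d` if `p = ∞`), with values in `[0, ∞]`. The `ℓ_q` norm is
the `L_q` norm for the counting measure on `ℕ`. -/
noncomputable def besovNorm {d : ℕ} (χ : EuclideanSpace ℝ (Fin d) → ℝ) (τ : ℝ) (p q : ℝ≥0∞)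
    (u : Distribution d) : ℝ≥0∞ :=
  eLpNorm (fun j : ℕ => ENNReal.ofReal ((2 : ℝ) ^ ((j : ℝ) * τ)) *
    eLpNorm (dyadicBlock χ u j) p volume) q Measure.count

/-- The Besov space `B^τ_{p,q}(𝕋^d)`, defined with the dyadic resolution of unity generated by `χ`.
As is well known, the space does not depend on the choice of `χ`. -/
def besovSpace {d : ℕ} (χ : EuclideanSpace ℝ (Fin d) → ℝ) (τ : ℝ) (p q : ℝ≥0∞) :
    Set (Distribution d) :=
  {u | besovNorm χ τ p q u < ∞}

end PeriodicNoise

namespace PeriodicNoise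

/-! ### Trigonometric polynomials with coefficients sampled from a smooth function -/

section ForwardDifference

variable {E F : Type*} [NormedAddCommGroup E] [NormedSpace ℝ E] [NormedAddCommGroup F]
  [NormedSpace ℝ F]

/-! The law of `w` is that of a random finite sum `∑ t_i δ_{r_i}`, so everything reduces to one
Dirac mass.

Analytic half. The `j`-th block of `δ_r` is a translate of the kernel `∑_k g(2^{-j}k) e^{2πi⟨k,x⟩}`
with `g` smooth and compactly supported. Multiplying it by `e^{-2πi x_i} - 1` takes a difference of
the coefficients, which gains a factor `2^{-j}`. The kernel is thus a bump of height `2^{jd}` and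
width `2^{-j}` with rapid decay (`exists_norm_dyadicKernel_mul_prod_le`), and its `L_p` norm is
`O(2^{jd(1-1/p)})` (`exists_eLpNorm_dyadicKernel_le`). This growth passes to finite linear
combinations. When `τ < d(1/p - 1)`, the weighted block norms are dominated by a geometric sequence
of ratio below one, hence lie in every `ℓ_q` (`HasDiracBlockGrowth.mem_besovSpace`).

Probabilistic half. Expanding the exponential shows that the Poisson mixture of laws of such sums
has the characteristic functional of `w` (`charFunctional_compoundPoissonLaw`), and this functional
determines the law (`ext_of_charFunctional`). No points or jumps need be constructed on `Ω`: it
suffices that all finite sums of Dirac masses lie in a measurable set on which the growth bound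
holds (`IsDyadicCutoff.exists_measurableSet_hasDiracBlockGrowth`). -/

theorem contDiff_fwdDiff {g : E → F} (hg : ContDiff ℝ (⊤ : ℕ∞) g) (h : E) :
    ContDiff ℝ (⊤ : ℕ∞) (fwdDiff h g) :=
  (hg.comp (contDiff_id.add contDiff_const)).sub hg

/-- Iterated differences are bounded by iterated derivatives. -/
theorem norm_fwdDiff_iterate_le (M : ℕ) {g : E → F} (hg : ContDiff ℝ (⊤ : ℕ∞) g) {C : ℝ}
    (hC : ∀ x, ‖iteratedFDeriv ℝ M g x‖ ≤ C) (h x : E) :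
    ‖(fwdDiff h)^[M] g x‖ ≤ C * ‖h‖ ^ M := by
  induction M generalizing g C with
  | zero => simpa using hC x
  | succ M ih =>
    rw [Function.iterate_succ_apply, pow_succ', ← mul_assoc]
    refine ih (contDiff_fwdDiff hg h) fun y => ?_
    have hM : ((M : ℕ) : WithTop ℕ∞) ≤ ((⊤ : ℕ∞) : WithTop ℕ∞) := by exact_mod_cast le_top
    have h1 : fwdDiff h g = (fun z => g (z + h)) - g := rfl
    have h2 : ContDiff ℝ M (fun z => g (z + h)) :=
      (hg.comp (contDiff_id.add contDiff_const)).of_le hM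
    rw [h1, iteratedFDeriv_sub_apply h2.contDiffAt (hg.of_le hM).contDiffAt,
      iteratedFDeriv_comp_add_right]
    have hd : Differentiable ℝ (iteratedFDeriv ℝ M g) :=
      hg.differentiable_iteratedFDeriv (by exact_mod_cast ENat.natCast_lt_top M)
    -- Mean value inequality for the `M`-th derivative: one difference trades one derivative for a
    -- factor `‖h‖`.
    have := Convex.norm_image_sub_le_of_norm_fderiv_le (𝕜 := ℝ) (f := iteratedFDeriv ℝ M g)
      (s := Set.univ) (x := y) (y := y + h) (C := C) (fun z _ => hd z)
      (fun z _ => by rw [norm_fderiv_iteratedFDeriv]; exact hC z) convex_univ trivial trivial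
    simpa using this

end ForwardDifference

/-! ### Finitely supported coefficients and summation by parts -/

variable {d : ℕ}

/-- `a` vanishes outside the cube `[-R, R]^d`. -/
def SupportedInCube (a : (Fin d → ℤ) → ℂ) (R : ℕ) : Prop :=
  ∀ k, a k ≠ 0 → ∀ i, |k i| ≤ R

/-- The integer points of the cube `[-R, R]^d`. -/
noncomputable def cube (d R : ℕ) : Finset (Fin d → ℤ) :=
  Fintype.piFinset fun _ => Finset.Icc (-(R : ℤ)) R

theorem card_cube (d R : ℕ) : (cube d R).card = (2 * R + 1) ^ d := by
  have : ((R : ℤ) + 1 + R).toNat = 2 * R + 1 := by omega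
  simp [cube, this]

theorem SupportedInCube.eq_zero {a : (Fin d → ℤ) → ℂ} {R : ℕ} (ha : SupportedInCube a R)
    {k : Fin d → ℤ} (hk : k ∉ cube d R) : a k = 0 := by
  by_contra h
  exact hk (Fintype.mem_piFinset.2 fun i => Finset.mem_Icc.2 (abs_le.1 (ha k h i)))

theorem SupportedInCube.tsum_eq {a : (Fin d → ℤ) → ℂ} {R : ℕ} (ha : SupportedInCube a R)
    (b : (Fin d → ℤ) → ℂ) : ∑' k, a k * b k = ∑ k ∈ cube d R, a k * b k :=
  tsum_eq_sum fun k hk => by rw [ha.eq_zero hk, zero_mul]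

theorem SupportedInCube.summable {a : (Fin d → ℤ) → ℂ} {R : ℕ} (ha : SupportedInCube a R)
    (b : (Fin d → ℤ) → ℂ) : Summable fun k => a k * b k :=
  summable_of_ne_finset_zero (s := cube d R) fun k hk => by rw [ha.eq_zero hk, zero_mul]

theorem SupportedInCube.norm_tsum_le {a : (Fin d → ℤ) → ℂ} {R : ℕ} (ha : SupportedInCube a R)
    {b : (Fin d → ℤ) → ℂ} {A B : ℝ} (hA : ∀ k, ‖a k‖ ≤ A) (hB : ∀ k, ‖b k‖ ≤ B) :
    ‖∑' k, a k * b k‖ ≤ (2 * R + 1) ^ d * (A * B) := by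
  rw [ha.tsum_eq]
  refine (norm_sum_le_of_le (cube d R) (f := fun k => a k * b k) (n := fun _ => A * B)
    fun k _ => ?_).trans ?_
  · rw [norm_mul]
    exact mul_le_mul (hA k) (hB k) (norm_nonneg _) ((norm_nonneg _).trans (hA k))
  · rw [Finset.sum_const, card_cube]
    simp

theorem SupportedInCube.fwdDiff {a : (Fin d → ℤ) → ℂ} {R : ℕ} (ha : SupportedInCube a R)
    (i : Fin d) : SupportedInCube (fwdDiff (Pi.single i 1) a) (R + 1) := by
  intro k hk j
  have h1 : |(Pi.single i 1 : Fin d → ℤ) j| ≤ 1 := by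
    by_cases h : j = i
    · subst h; simp
    · simp [h]
  rw [abs_le] at h1
  by_cases h : a k = 0
  · have h2 : a (k + Pi.single i 1) ≠ 0 := fun h' => hk (by simp [_root_.fwdDiff, h, h'])
    have := abs_le.1 (ha _ h2 j)
    rw [Pi.add_apply] at this
    rw [abs_le]; push_cast; omega
  · have := abs_le.1 (ha _ h j)
    rw [abs_le]; push_cast; omega

theorem SupportedInCube.fwdDiff_iterate {a : (Fin d → ℤ) → ℂ} {R : ℕ} (ha : SupportedInCube a R)
    (i : Fin d) (M : ℕ) :
    SupportedInCube ((_root_.fwdDiff (Pi.single i 1))^[M] a) (R + M) := by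
  induction M with
  | zero => simpa using ha
  | succ M ih =>
    rw [Function.iterate_succ_apply']
    exact ih.fwdDiff i

/-- Summation by parts. -/
theorem SupportedInCube.mul_tsum_mFourier {a : (Fin d → ℤ) → ℂ} {R : ℕ}
    (ha : SupportedInCube a R) (i : Fin d) (x : UnitAddTorus (Fin d)) :
    (UnitAddTorus.mFourier (-Pi.single i 1) x - 1) * ∑' k, a k * UnitAddTorus.mFourier k x =
      ∑' k, _root_.fwdDiff (Pi.single i 1) a k * UnitAddTorus.mFourier k x := by
  have hs : Summable fun k => a k * UnitAddTorus.mFourier k x := ha.summable _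
  have hs' : Summable fun k => a (k + Pi.single i 1) * UnitAddTorus.mFourier k x := by
    have : Summable fun k => (a k * UnitAddTorus.mFourier k x) *
        UnitAddTorus.mFourier (-Pi.single i 1) x := hs.mul_right _
    rw [← (Equiv.addRight (Pi.single i 1 : Fin d → ℤ)).summable_iff] at this
    refine this.congr fun k => ?_
    simp only [Function.comp_apply, Equiv.coe_addRight]
    rw [mul_assoc, ← UnitAddTorus.mFourier_add]
    simp
  -- Reindexing by `k ↦ k + e_i` turns multiplication by `e^{-2πi x_i}` into a shift of the
  -- coefficients.
  have h1 : ∑' k, a (k + Pi.single i 1) * UnitAddTorus.mFourier k x =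
      UnitAddTorus.mFourier (-Pi.single i 1) x * ∑' k, a k * UnitAddTorus.mFourier k x := by
    rw [← tsum_mul_left, ← (Equiv.addRight (Pi.single i 1 : Fin d → ℤ)).tsum_eq (fun k =>
      UnitAddTorus.mFourier (-Pi.single i 1) x * (a k * UnitAddTorus.mFourier k x))]
    refine tsum_congr fun k => ?_
    simp only [Equiv.coe_addRight]
    rw [mul_left_comm, ← UnitAddTorus.mFourier_add]
    simp
  rw [sub_mul, one_mul, ← h1, ← hs'.tsum_sub hs]
  exact tsum_congr fun k => by rw [_root_.fwdDiff, sub_mul]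

theorem SupportedInCube.pow_mul_tsum_mFourier {a : (Fin d → ℤ) → ℂ} {R : ℕ}
    (ha : SupportedInCube a R) (i : Fin d) (M : ℕ) (x : UnitAddTorus (Fin d)) :
    (UnitAddTorus.mFourier (-Pi.single i 1) x - 1) ^ M * ∑' k, a k * UnitAddTorus.mFourier k x =
      ∑' k, (_root_.fwdDiff (Pi.single i 1))^[M] a k * UnitAddTorus.mFourier k x := by
  induction M with
  | zero => simp
  | succ M ih =>
    rw [pow_succ', mul_assoc, ih, (ha.fwdDiff_iterate i M).mul_tsum_mFourier,
      Function.iterate_succ_apply']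

theorem norm_mFourier_apply (k : Fin d → ℤ) (x : UnitAddTorus (Fin d)) :
    ‖UnitAddTorus.mFourier k x‖ = 1 := by
  simp only [UnitAddTorus.mFourier, fourier_apply, ContinuousMap.coe_mk, norm_prod,
    Circle.norm_coe, Finset.prod_const_one]

/-! ### Kernels with coefficients sampled on a dyadic lattice -/

/-- The integer point `k`, as a point of the Euclidean space. -/
noncomputable def latticePoint (k : Fin d → ℤ) : EuclideanSpace ℝ (Fin d) :=
  WithLp.toLp 2 fun i => (k i : ℝ)

theorem latticePoint_add (k l : Fin d → ℤ) :
    latticePoint (k + l) = latticePoint k + latticePoint l := by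
  ext i; simp [latticePoint]

/-- The values of `g` at the points of the lattice `2^{-n} ℤ^d`. -/
noncomputable def dyadicSample (g : EuclideanSpace ℝ (Fin d) → ℝ) (n : ℕ) (k : Fin d → ℤ) : ℂ :=
  (g (((2 : ℝ) ^ n)⁻¹ • latticePoint k) : ℂ)

/-- The trigonometric polynomial `∑_k g(2^{-n} k) exp(2πi ⟨k, x⟩)`. -/
noncomputable def dyadicKernel (g : EuclideanSpace ℝ (Fin d) → ℝ) (n : ℕ)
    (x : UnitAddTorus (Fin d)) : ℂ :=
  ∑' k, dyadicSample g n k * UnitAddTorus.mFourier k x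

/-- Sampling at scale `2^{-n}` shrinks the difference step to `2^{-n} h`, so each difference of the
coefficients gains a factor `2^{-n}`. -/
theorem dyadicSample_fwdDiff_iterate (g : EuclideanSpace ℝ (Fin d) → ℝ) (n M : ℕ)
    (h k : Fin d → ℤ) :
    (fwdDiff h)^[M] (dyadicSample g n) k =
      dyadicSample ((fwdDiff (((2 : ℝ) ^ n)⁻¹ • latticePoint h))^[M] g) n k := by
  induction M generalizing g with
  | zero => rfl
  | succ M ih =>
    have : fwdDiff h (dyadicSample g n) =
        dyadicSample (fwdDiff (((2 : ℝ) ^ n)⁻¹ • latticePoint h) g) n := by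
      funext k
      simp [fwdDiff, dyadicSample, latticePoint_add]
    rw [Function.iterate_succ_apply, this, ih, Function.iterate_succ_apply]

theorem supportedInCube_dyadicSample {g : EuclideanSpace ℝ (Fin d) → ℝ}
    (hg0 : ∀ ξ, 2 ≤ ‖ξ‖ → g ξ = 0) (n : ℕ) :
    SupportedInCube (dyadicSample g n) (2 * 2 ^ n) := by
  intro k hk i
  by_contra! h
  refine hk ?_
  rw [dyadicSample, hg0, Complex.ofReal_zero]
  have h1 : |(k i : ℝ)| ≤ ‖latticePoint k‖ := by
    simpa [latticePoint] using PiLp.norm_apply_le (latticePoint k) i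
  have h2 : (2 * 2 ^ n : ℝ) ≤ |(k i : ℝ)| := by exact_mod_cast h.le
  rw [norm_smul, norm_inv, norm_pow, Real.norm_ofNat, ← div_eq_inv_mul, le_div_iff₀ (by positivity)]
  exact h2.trans h1

theorem norm_latticePoint_single (i : Fin d) :
    ‖latticePoint (Pi.single i 1 : Fin d → ℤ)‖ = 1 := by
  have : latticePoint (Pi.single i 1 : Fin d → ℤ) = EuclideanSpace.single i (1 : ℝ) := by
    ext j
    by_cases h : j = i
    · subst h; simp [latticePoint]
    · simp [latticePoint, h]
  rw [this]; simp

theorem exists_norm_iteratedFDeriv_le {g : EuclideanSpace ℝ (Fin d) → ℝ}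
    (hg : ContDiff ℝ (⊤ : ℕ∞) g) (hg0 : ∀ ξ, 2 ≤ ‖ξ‖ → g ξ = 0) (M : ℕ) :
    ∃ C, ∀ ξ, ‖iteratedFDeriv ℝ M g ξ‖ ≤ C := by
  have hc : HasCompactSupport g := by
    refine HasCompactSupport.intro (isCompact_closedBall (0 : EuclideanSpace ℝ (Fin d)) 2) ?_
    intro ξ hξ
    refine hg0 ξ ?_
    simp only [Metric.mem_closedBall, dist_zero_right, not_le] at hξ
    exact hξ.le
  exact (hc.iteratedFDeriv M).exists_bound_of_continuous
    (hg.continuous_iteratedFDeriv (by exact_mod_cast le_top))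

theorem norm_mFourier_neg_single_sub_one (i : Fin d) (x : UnitAddTorus (Fin d)) :
    ‖UnitAddTorus.mFourier (-Pi.single i 1) x - 1‖ = ‖(fourier 1 (x i) : ℂ) - 1‖ := by
  rw [UnitAddTorus.mFourier_neg, UnitAddTorus.mFourier_single, ← RCLike.norm_conj]
  simp

/-- There are `O(2^{nd})` nonzero coefficients. Summing by parts `M` times in direction `i` makes
them `O(2^{-nM})`, which pays for the factor `(2^n)^M`. -/
theorem exists_pow_mul_norm_dyadicKernel_le {g : EuclideanSpace ℝ (Fin d) → ℝ}
    (hg : ContDiff ℝ (⊤ : ℕ∞) g) (hg0 : ∀ ξ, 2 ≤ ‖ξ‖ → g ξ = 0) (M : ℕ) :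
    ∃ C, 0 ≤ C ∧ ∀ n x, ‖dyadicKernel g n x‖ ≤ C * 2 ^ (n * d) ∧ ∀ i,
      (2 ^ n * ‖(fourier 1 (x i) : ℂ) - 1‖) ^ M * ‖dyadicKernel g n x‖ ≤ C * 2 ^ (n * d) := by
  obtain ⟨C₀, hC₀⟩ := exists_norm_iteratedFDeriv_le hg hg0 0
  obtain ⟨C₁, hC₁⟩ := exists_norm_iteratedFDeriv_le hg hg0 M
  have hC₀0 : 0 ≤ C₀ := (norm_nonneg _).trans (hC₀ 0)
  have hC₁0 : 0 ≤ C₁ := (norm_nonneg _).trans (hC₁ 0)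
  -- `M` differences enlarge the supporting cube to radius `2·2^n + M`, and `2(2·2^n + M) + 1 ≤ (2M
  -- + 5) 2^n`.
  have hcard : ∀ n : ℕ, (2 * ((2 * 2 ^ n + M : ℕ) : ℝ) + 1) ^ d ≤ (2 * M + 5) ^ d * 2 ^ (n * d) := by
    intro n
    rw [pow_mul, ← mul_pow]
    have h1 : (1 : ℝ) ≤ 2 ^ n := one_le_pow₀ (by norm_num)
    gcongr
    push_cast
    have : (M : ℝ) ≤ M * 2 ^ n := le_mul_of_one_le_right (Nat.cast_nonneg M) h1
    linarith
  have hone : ∀ (x : UnitAddTorus (Fin d)) (k : Fin d → ℤ), ‖UnitAddTorus.mFourier k x‖ ≤ 1 :=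
    fun x k => (norm_mFourier_apply k x).le
  refine ⟨(2 * M + 5) ^ d * max C₀ C₁, by positivity, fun n x => ⟨?_, fun i => ?_⟩⟩
  · refine ((supportedInCube_dyadicSample hg0 n).norm_tsum_le (A := max C₀ C₁) (fun k => ?_)
      (hone x)).trans ?_
    · rw [dyadicSample, Complex.norm_real]
      simpa using Or.inl (hC₀ _)
    · rw [mul_one, mul_right_comm]
      gcongr
      refine le_trans ?_ (hcard n)
      gcongr
      omega
  · rw [mul_pow, ← norm_mFourier_neg_single_sub_one, ← norm_pow, mul_assoc, ← norm_mul,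
      dyadicKernel, (supportedInCube_dyadicSample hg0 n).pow_mul_tsum_mFourier]
    refine (mul_le_mul_of_nonneg_left
      (((supportedInCube_dyadicSample hg0 n).fwdDiff_iterate i M).norm_tsum_le
        (A := max C₀ C₁ * ((2 ^ n)⁻¹) ^ M) (fun k => ?_) (hone x)) (by positivity)).trans ?_
    · rw [dyadicSample_fwdDiff_iterate, dyadicSample, Complex.norm_real]
      refine (norm_fwdDiff_iterate_le M hg hC₁ _ _).trans ?_
      rw [norm_smul, norm_latticePoint_single, mul_one, norm_inv, norm_pow, Real.norm_ofNat]
      gcongr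
      exact le_max_right _ _
    · have : ((2 : ℝ) ^ n) ^ M * ((2 * ((2 * 2 ^ n + M : ℕ) : ℝ) + 1) ^ d *
          (max C₀ C₁ * ((2 ^ n)⁻¹) ^ M * 1)) =
          (2 * ((2 * 2 ^ n + M : ℕ) : ℝ) + 1) ^ d * max C₀ C₁ := by
        rw [inv_pow]; field_simp
      rw [this, mul_right_comm]
      gcongr
      exact hcard n

/-- The kernels decay rapidly away from the origin, at the scale `2^{-n}`. -/
theorem exists_norm_dyadicKernel_mul_prod_le {g : EuclideanSpace ℝ (Fin d) → ℝ}
    (hg : ContDiff ℝ (⊤ : ℕ∞) g) (hg0 : ∀ ξ, 2 ≤ ‖ξ‖ → g ξ = 0) (L : ℕ) :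
    ∃ C, 0 ≤ C ∧ ∀ n x, ‖dyadicKernel g n x‖ *
      ∏ i, (1 + 2 ^ n * ‖(fourier 1 (x i) : ℂ) - 1‖) ^ L ≤ C * 2 ^ (n * d) := by
  -- Decay of order `L * d` in each coordinate separately gives, by a geometric mean over the `d`
  -- coordinates, decay of order `L` in all of them jointly.
  obtain ⟨C, hC, h⟩ := exists_pow_mul_norm_dyadicKernel_le hg hg0 (L * d)
  refine ⟨2 ^ (L * d) * C, by positivity, fun n x => ?_⟩
  have hi : ∀ i, ‖dyadicKernel g n x‖ * (1 + 2 ^ n * ‖(fourier 1 (x i) : ℂ) - 1‖) ^ (L * d) ≤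
      2 ^ (L * d) * C * 2 ^ (n * d) := by
    intro i
    set N : ℝ := 2 ^ n * ‖(fourier 1 (x i) : ℂ) - 1‖ with hN
    -- According as `N ≤ 1` or `N ≥ 1`, the factor `1 + N` is at most `2` or `2 * N`; hence the
    -- constant `2 ^ (L * d)`.
    have hN0 : 0 ≤ N := by positivity
    rcases le_total N 1 with h1 | h1
    · calc _ ≤ ‖dyadicKernel g n x‖ * 2 ^ (L * d) := by gcongr; linarith
        _ ≤ C * 2 ^ (n * d) * 2 ^ (L * d) :=
          mul_le_mul_of_nonneg_right (h n x).1 (by positivity)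
        _ = _ := by ring
    · calc _ ≤ ‖dyadicKernel g n x‖ * (2 * N) ^ (L * d) := by gcongr; linarith
        _ = 2 ^ (L * d) * (N ^ (L * d) * ‖dyadicKernel g n x‖) := by rw [mul_pow]; ring
        _ ≤ 2 ^ (L * d) * (C * 2 ^ (n * d)) :=
          mul_le_mul_of_nonneg_left ((h n x).2 i) (by positivity)
        _ = _ := by ring
  rcases Nat.eq_zero_or_pos d with rfl | hd
  · simpa using (h n x).1
  · refine le_of_pow_le_pow_left₀ hd.ne' (by positivity) ?_
    calc _ = ∏ i, ‖dyadicKernel g n x‖ *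
          (1 + 2 ^ n * ‖(fourier 1 (x i) : ℂ) - 1‖) ^ (L * d) := by
          rw [mul_pow, Finset.prod_mul_distrib, ← Finset.prod_pow]
          simp [pow_mul]
      _ ≤ ∏ _i : Fin d, 2 ^ (L * d) * C * 2 ^ (n * d) :=
          Finset.prod_le_prod (fun i _ => by positivity) fun i _ => hi i
      _ = _ := by simp

/-! ### `L_p` bounds for the kernels -/

instance isProbabilityMeasure_volume_unitAddCircle :
    IsProbabilityMeasure (volume : Measure UnitAddCircle) :=
  ⟨by simp⟩

/-- Here `|e^{2πit} - 1| = 2|sin πt|`, and Jordan's inequality bounds the sine below on `[-π/2,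
π/2]`. -/
theorem four_mul_abs_le_norm_fourier_one_sub_one {t : ℝ} (ht : |t| ≤ 1 / 2) :
    4 * |t| ≤ ‖(fourier 1 (t : UnitAddCircle) : ℂ) - 1‖ := by
  have h1 : (fourier 1 (t : UnitAddCircle) : ℂ) =
      Complex.exp (Complex.I * ((2 * Real.pi * t : ℝ) : ℂ)) := by
    rw [fourier_coe_apply]
    congr 1
    push_cast
    ring
  rw [h1, Complex.norm_exp_I_mul_ofReal_sub_one, norm_mul, Real.norm_ofNat, Real.norm_eq_abs]
  have h2 : 2 * Real.pi * t / 2 = Real.pi * t := by ring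
  have h3 : |Real.pi * t| ≤ Real.pi / 2 := by
    rw [abs_mul, abs_of_pos Real.pi_pos]
    nlinarith [Real.pi_pos]
  have h4 := Real.mul_abs_le_abs_sin h3
  rw [abs_mul, abs_of_pos Real.pi_pos] at h4
  have h5 : 2 / Real.pi * (Real.pi * |t|) = 2 * |t| := by field_simp
  rw [h2]
  linarith

/-- On the fundamental domain `(-1/2, 1/2]` the weight is at most `(1 + |2^n t|)^{-2}`; extending to
the line and rescaling gives the factor `2^{-n}`. Any exponent below `-1` would make the right side
finite. -/
theorem lintegral_fourier_weight_le (n : ℕ) :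
    ∫⁻ t : UnitAddCircle,
      ENNReal.ofReal ((1 + 2 ^ n * ‖(fourier 1 t : ℂ) - 1‖) ^ (-2 : ℝ)) ≤
    ENNReal.ofReal (((2 : ℝ) ^ n)⁻¹) * ∫⁻ s : ℝ, ENNReal.ofReal ((1 + ‖s‖) ^ (-2 : ℝ)) := by
  have hpos : (0 : ℝ) < 2 ^ n := by positivity
  rw [← UnitAddCircle.lintegral_preimage (-1 / 2)]
  calc _ ≤ ∫⁻ t in Set.Ioc (-1 / 2 : ℝ) (-1 / 2 + 1),
        ENNReal.ofReal ((1 + ‖2 ^ n * t‖) ^ (-2 : ℝ)) := by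
        refine setLIntegral_mono' measurableSet_Ioc fun t ht => ENNReal.ofReal_le_ofReal ?_
        refine Real.rpow_le_rpow_of_nonpos (by positivity) ?_ (by norm_num)
        have h1 : |t| ≤ 1 / 2 := abs_le.2 ⟨by linarith [ht.1], by linarith [ht.2]⟩
        have h2 := four_mul_abs_le_norm_fourier_one_sub_one h1
        rw [norm_mul, Real.norm_of_nonneg hpos.le, Real.norm_eq_abs]
        gcongr
        linarith [abs_nonneg t]
    _ ≤ ∫⁻ t : ℝ, ENNReal.ofReal ((1 + ‖2 ^ n * t‖) ^ (-2 : ℝ)) := setLIntegral_le_lintegral _ _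
    _ = ∫⁻ s, ENNReal.ofReal ((1 + ‖s‖) ^ (-2 : ℝ)) ∂(Measure.map ((2 : ℝ) ^ n * ·) volume) := by
        rw [lintegral_map (by fun_prop) (by fun_prop)]
    _ = _ := by
        rw [Real.map_volume_mul_left hpos.ne', lintegral_smul_measure, abs_of_pos (by positivity),
          smul_eq_mul]

theorem lintegral_prod_unitAddTorus {d : ℕ} {f : UnitAddCircle → ℝ≥0∞} (hf : Measurable f) :
    ∫⁻ x : UnitAddTorus (Fin d), ∏ i, f (x i) = (∫⁻ t, f t) ^ d := by
  have h := ProbabilityTheory.lintegral_prod_eq_prod_lintegral_of_indepFun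
    (μ := Measure.pi fun _ : Fin d => (volume : Measure UnitAddCircle)) Finset.univ
    (fun i x => f (x i)) (ProbabilityTheory.iIndepFun_pi fun _ => hf.aemeasurable)
    fun i => hf.comp (measurable_pi_apply i)
  refine h.trans ?_
  have : ∀ i : Fin d, ∫⁻ x, f (x i) ∂(Measure.pi fun _ : Fin d =>
      (volume : Measure UnitAddCircle)) = ∫⁻ t, f t := fun i =>
    (measurePreserving_eval (fun _ : Fin d => (volume : Measure UnitAddCircle)) i).lintegral_comp hf
  simp [this]

/-- The size `2^{j d (1 - 1/p)}` of the `L_p` norm of an `L_1`-normalized bump of width `2^{-j}`. -/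
noncomputable def blockRate (d : ℕ) (p : ℝ≥0∞) (j : ℕ) : ℝ≥0∞ :=
  ENNReal.ofReal ((2 : ℝ) ^ ((j : ℝ) * (d * (1 - (p⁻¹).toReal))))

theorem exists_eLpNorm_dyadicKernel_le {g : EuclideanSpace ℝ (Fin d) → ℝ}
    (hg : ContDiff ℝ (⊤ : ℕ∞) g) (hg0 : ∀ ξ, 2 ≤ ‖ξ‖ → g ξ = 0) {p : ℝ≥0∞} (hp : 0 < p) :
    ∃ C : ℝ≥0∞, C ≠ ∞ ∧ ∀ n, eLpNorm (dyadicKernel g n) p volume ≤ C * blockRate d p n := by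
  rcases eq_or_ne p ∞ with rfl | hp'
  · obtain ⟨C, hC, h⟩ := exists_norm_dyadicKernel_mul_prod_le hg hg0 0
    refine ⟨ENNReal.ofReal C, ENNReal.ofReal_ne_top, fun n => ?_⟩
    have hn : ∀ x, ‖dyadicKernel g n x‖ ≤ C * 2 ^ (n * d) := fun x => by simpa using h n x
    refine (eLpNorm_le_of_ae_bound (Filter.Eventually.of_forall hn)).trans (le_of_eq ?_)
    rw [blockRate, ← ENNReal.ofReal_mul hC]
    simp only [ENNReal.toReal_top, inv_zero, ENNReal.rpow_zero, one_mul, ENNReal.inv_top,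
      ENNReal.toReal_zero, sub_zero, mul_one]
    congr 2
    rw [← Nat.cast_mul, Real.rpow_natCast]
  set r := p.toReal with hr
  have hr0 : 0 < r := ENNReal.toReal_pos hp.ne' hp'
  -- With `L * r ≥ 2`, the `r`-th power of the kernel is dominated by a product of integrable
  -- weights of exponent `-2`, one per coordinate.
  obtain ⟨L, hL⟩ := exists_nat_ge (2 / r)
  rw [div_le_iff₀ hr0] at hL
  obtain ⟨C, hC, h⟩ := exists_norm_dyadicKernel_mul_prod_le hg hg0 L
  set J := ∫⁻ s : ℝ, ENNReal.ofReal ((1 + ‖s‖) ^ (-2 : ℝ)) with hJ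
  have hJtop : J ≠ ∞ := (finite_integral_one_add_norm (by simp)).ne
  refine ⟨ENNReal.ofReal C * (J ^ d) ^ (1 / r), ENNReal.mul_ne_top ENNReal.ofReal_ne_top
    (ENNReal.rpow_ne_top_of_nonneg (by positivity) (ENNReal.pow_ne_top hJtop)), fun n => ?_⟩
  have hpt : ∀ x, ‖dyadicKernel g n x‖ₑ ^ r ≤ ENNReal.ofReal (C * 2 ^ (n * d)) ^ r *
      ∏ i, ENNReal.ofReal ((1 + 2 ^ n * ‖(fourier 1 (x i) : ℂ) - 1‖) ^ (-2 : ℝ)) := by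
    intro x
    rw [← ENNReal.ofReal_prod_of_nonneg fun i _ => by positivity,
      ENNReal.ofReal_rpow_of_nonneg (by positivity) hr0.le, ← ENNReal.ofReal_mul (by positivity),
      ← ofReal_norm, ENNReal.ofReal_rpow_of_nonneg (norm_nonneg _) hr0.le]
    refine ENNReal.ofReal_le_ofReal ?_
    have h1 : ‖dyadicKernel g n x‖ ^ r *
        ∏ i, (1 + 2 ^ n * ‖(fourier 1 (x i) : ℂ) - 1‖) ^ (2 : ℝ) ≤ (C * 2 ^ (n * d)) ^ r := by
      refine le_trans ?_ (Real.rpow_le_rpow (by positivity) (h n x) hr0.le)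
      rw [Real.mul_rpow (norm_nonneg _) (by positivity),
        ← Real.finsetProd_rpow _ _ fun i _ => by positivity]
      gcongr with i
      rw [← Real.rpow_natCast _ L, ← Real.rpow_mul (by positivity)]
      refine Real.rpow_le_rpow_of_exponent_le ?_ hL
      have : 0 ≤ (2 : ℝ) ^ n * ‖(fourier 1 (x i) : ℂ) - 1‖ := by positivity
      linarith
    simp_rw [Real.rpow_neg (by positivity : (0 : ℝ) ≤ 1 + 2 ^ n * ‖(fourier 1 (x _) : ℂ) - 1‖)]
    rw [Finset.prod_inv_distrib, ← div_eq_mul_inv, le_div_iff₀]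
    · exact h1
    · exact Finset.prod_pos fun i _ => by positivity
  have hint : ∫⁻ x, ‖dyadicKernel g n x‖ₑ ^ r ≤
      ENNReal.ofReal (C * 2 ^ (n * d)) ^ r * (ENNReal.ofReal (((2 : ℝ) ^ n)⁻¹) * J) ^ d := by
    refine (lintegral_mono hpt).trans ?_
    rw [lintegral_const_mul' _ _ (ENNReal.rpow_ne_top_of_nonneg hr0.le ENNReal.ofReal_ne_top),
      lintegral_prod_unitAddTorus (f := fun t => ENNReal.ofReal
        ((1 + 2 ^ n * ‖(fourier 1 t : ℂ) - 1‖) ^ (-2 : ℝ))) (by fun_prop)]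
    gcongr
    exact lintegral_fourier_weight_le n
  rw [eLpNorm_eq_lintegral_rpow_enorm_toReal hp.ne' hp', ← hr]
  refine (ENNReal.rpow_le_rpow hint (by positivity)).trans (le_of_eq ?_)
  rw [ENNReal.mul_rpow_of_nonneg _ _ (by positivity), ← ENNReal.rpow_mul, mul_one_div_cancel hr0.ne',
    ENNReal.rpow_one, mul_pow, ENNReal.mul_rpow_of_nonneg _ _ (by positivity),
    ENNReal.ofReal_mul hC, blockRate, ENNReal.toReal_inv, ← hr,
    ← ENNReal.ofReal_pow (by positivity), ENNReal.ofReal_rpow_of_nonneg (by positivity)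
      (by positivity)]
  have : (2 : ℝ) ^ ((n : ℝ) * (d * (1 - r⁻¹))) = 2 ^ (n * d) * ((((2 : ℝ) ^ n)⁻¹) ^ d) ^ (1 / r) := by
    rw [← Real.rpow_natCast, ← Real.rpow_natCast, ← Real.rpow_natCast, ← Real.rpow_neg (by norm_num),
      ← Real.rpow_mul (by norm_num), ← Real.rpow_mul (by norm_num), ← Real.rpow_add (by norm_num)]
    congr 1
    push_cast
    ring
  rw [this, ENNReal.ofReal_mul (by positivity)]
  ring

/-! ### Distributions whose dyadic blocks are as large as those of a Dirac mass -/

/-- The `L_p` norms of the dyadic blocks of `u` grow at most like those of a Dirac mass. -/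
def HasDiracBlockGrowth (χ : EuclideanSpace ℝ (Fin d) → ℝ) (p : ℝ≥0∞) (u : Distribution d) :
    Prop :=
  ∃ C : ℕ, ∀ j, eLpNorm (dyadicBlock χ u j) p volume ≤ C * blockRate d p j

/-- The natural-number constant in `HasDiracBlockGrowth` makes the growth condition a countable
union, hence measurable for finite `p`; any finite constant may be rounded up to one. -/
theorem hasDiracBlockGrowth_of_ne_top {χ : EuclideanSpace ℝ (Fin d) → ℝ} {p : ℝ≥0∞}
    {u : Distribution d} {C : ℝ≥0∞} (hC : C ≠ ∞)
    (h : ∀ j, eLpNorm (dyadicBlock χ u j) p volume ≤ C * blockRate d p j) :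
    HasDiracBlockGrowth χ p u := by
  obtain ⟨N, hN⟩ := ENNReal.exists_nat_gt hC
  exact ⟨N, fun j => (h j).trans (by gcongr)⟩

theorem eLpNorm_geometric_lt_top {ρ : ℝ} (hρ : 0 < ρ) (hρ' : ρ < 1) (q : ℝ≥0∞) (hq : 0 < q)
    {C : ℝ≥0∞} (hC : C ≠ ∞) :
    eLpNorm (fun j : ℕ => C * ENNReal.ofReal (ρ ^ j)) q Measure.count < ∞ := by
  rcases eq_or_ne q ∞ with rfl | hq'
  · rw [eLpNorm_exponent_top]
    refine lt_of_le_of_lt (eLpNormEssSup_le_of_ae_enorm_bound (C := C)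
      (Filter.Eventually.of_forall fun j => ?_)) hC.lt_top
    rw [enorm_eq_self]
    refine mul_le_of_le_one_right' (ENNReal.ofReal_le_one.2 (pow_le_one₀ hρ.le hρ'.le))
  have hr0 : 0 < q.toReal := ENNReal.toReal_pos hq.ne' hq'
  rw [eLpNorm_lt_top_iff_lintegral_rpow_enorm_lt_top hq.ne' hq', lintegral_count]
  have h1 : ∀ j : ℕ, ‖C * ENNReal.ofReal (ρ ^ j)‖ₑ ^ q.toReal =
      C ^ q.toReal * ENNReal.ofReal (ρ ^ q.toReal) ^ j := by
    intro j
    rw [enorm_eq_self, ENNReal.mul_rpow_of_nonneg _ _ hr0.le,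
      ENNReal.ofReal_rpow_of_nonneg (by positivity) hr0.le, ← ENNReal.ofReal_pow (by positivity),
      ← Real.rpow_natCast, ← Real.rpow_mul hρ.le, mul_comm (j : ℝ), Real.rpow_mul hρ.le,
      Real.rpow_natCast]
  simp_rw [h1]
  rw [ENNReal.tsum_mul_left, ENNReal.tsum_geometric]
  refine ENNReal.mul_lt_top (ENNReal.rpow_lt_top_of_nonneg hr0.le hC) ?_
  rw [ENNReal.inv_lt_top, tsub_pos_iff_lt, ENNReal.ofReal_lt_one]
  exact Real.rpow_lt_one hρ.le hρ' hr0

theorem HasDiracBlockGrowth.mem_besovSpace {χ : EuclideanSpace ℝ (Fin d) → ℝ} {τ : ℝ}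
    {p q : ℝ≥0∞} {u : Distribution d} (hu : HasDiracBlockGrowth χ p u) (hq : 0 < q)
    (hτ : τ < (d : ℝ) * ((p⁻¹).toReal - 1)) : u ∈ besovSpace χ τ p q := by
  obtain ⟨C, hC⟩ := hu
  -- The only use of the condition on `τ`: `2^{jτ} * blockRate d p j` is the `j`-th power of this
  -- ratio.
  have hρ' : (2 : ℝ) ^ (τ - d * ((p⁻¹).toReal - 1)) < 1 :=
    Real.rpow_lt_one_of_one_lt_of_neg (by norm_num) (by linarith)
  refine lt_of_le_of_lt (eLpNorm_mono_enorm fun j => ?_)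
    (eLpNorm_geometric_lt_top (by positivity) hρ' q hq (ENNReal.natCast_ne_top C))
  rw [enorm_eq_self, enorm_eq_self]
  calc _ ≤ ENNReal.ofReal ((2 : ℝ) ^ ((j : ℝ) * τ)) * (C * blockRate d p j) := by
        gcongr; exact hC j
    _ = _ := by
        rw [blockRate, mul_left_comm, ← ENNReal.ofReal_mul (by positivity),
          ← Real.rpow_add (by norm_num), ← Real.rpow_natCast, ← Real.rpow_mul (by norm_num)]
        congr 4
        ring

/-! ### Dyadic blocks as finite sums -/

/-- The function whose dilation by `2^{-j}` is the `j`-th piece of the dyadic resolution of unity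
generated by `χ`. -/
noncomputable def blockProfile (χ : EuclideanSpace ℝ (Fin d) → ℝ) :
    ℕ → EuclideanSpace ℝ (Fin d) → ℝ
  | 0 => χ
  | _ + 1 => fun ξ => χ ξ - χ ((2 : ℝ) • ξ)

theorem dyadicPiece_eq_dyadicSample (χ : EuclideanSpace ℝ (Fin d) → ℝ) (j : ℕ) (k : Fin d → ℤ) :
    (dyadicPiece χ j (WithLp.toLp 2 fun i => (k i : ℝ)) : ℂ) =
      dyadicSample (blockProfile χ j) j k := by
  cases j with
  | zero => simp [dyadicPiece, dyadicSample, blockProfile, latticePoint]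
  | succ j =>
    have : ((2 : ℝ) ^ j)⁻¹ = 2 * (2 ^ (j + 1))⁻¹ := by
      rw [pow_succ]; field_simp
    simp only [dyadicPiece, dyadicSample, blockProfile, latticePoint, smul_smul, this]

theorem IsDyadicCutoff.blockProfile_contDiff {χ : EuclideanSpace ℝ (Fin d) → ℝ}
    (hχ : IsDyadicCutoff χ) (j : ℕ) : ContDiff ℝ (⊤ : ℕ∞) (blockProfile χ j) := by
  cases j with
  | zero => exact hχ.contDiff
  | succ j => exact hχ.contDiff.sub (hχ.contDiff.comp (contDiff_const_smul (2 : ℝ)))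

theorem IsDyadicCutoff.blockProfile_eq_zero {χ : EuclideanSpace ℝ (Fin d) → ℝ}
    (hχ : IsDyadicCutoff χ) (j : ℕ) (ξ : EuclideanSpace ℝ (Fin d)) (hξ : 2 ≤ ‖ξ‖) :
    blockProfile χ j ξ = 0 := by
  have h1 : χ ξ = 0 := hχ.eq_zero ξ (by linarith)
  cases j with
  | zero => exact h1
  | succ j =>
    have h2 : χ ((2 : ℝ) • ξ) = 0 := hχ.eq_zero _ (by rw [norm_smul, Real.norm_ofNat]; linarith)
    simp [blockProfile, h1, h2]

theorem IsDyadicCutoff.supportedInCube {χ : EuclideanSpace ℝ (Fin d) → ℝ}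
    (hχ : IsDyadicCutoff χ) (j : ℕ) :
    SupportedInCube (dyadicSample (blockProfile χ j) j) (2 * 2 ^ j) :=
  supportedInCube_dyadicSample (hχ.blockProfile_eq_zero j) j

theorem dyadicBlock_eq_tsum (χ : EuclideanSpace ℝ (Fin d) → ℝ) (u : Distribution d) (j : ℕ)
    (x : UnitAddTorus (Fin d)) : dyadicBlock χ u j x =
      ∑' k, dyadicSample (blockProfile χ j) j k *
        (fourierCoeff u k * UnitAddTorus.mFourier k x) := by
  simp only [dyadicBlock, dyadicPiece_eq_dyadicSample, mul_assoc]

theorem IsDyadicCutoff.dyadicBlock_eq_sum {χ : EuclideanSpace ℝ (Fin d) → ℝ}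
    (hχ : IsDyadicCutoff χ) (u : Distribution d) (j : ℕ) (x : UnitAddTorus (Fin d)) :
    dyadicBlock χ u j x = ∑ k ∈ cube d (2 * 2 ^ j), dyadicSample (blockProfile χ j) j k *
        (fourierCoeff u k * UnitAddTorus.mFourier k x) := by
  rw [dyadicBlock_eq_tsum, (hχ.supportedInCube j).tsum_eq]

theorem fourierCoeff_zero (k : Fin d → ℤ) : fourierCoeff (0 : Distribution d) k = 0 := by
  simp [fourierCoeff]

theorem fourierCoeff_add (u v : Distribution d) (k : Fin d → ℤ) :
    fourierCoeff (u + v) k = fourierCoeff u k + fourierCoeff v k := by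
  simp only [fourierCoeff, add_apply]
  push_cast
  ring

theorem fourierCoeff_smul (c : ℝ) (u : Distribution d) (k : Fin d → ℤ) :
    fourierCoeff (c • u) k = c * fourierCoeff u k := by
  simp only [fourierCoeff, smul_apply, smul_eq_mul]
  push_cast
  ring

theorem IsDyadicCutoff.dyadicBlock_add {χ : EuclideanSpace ℝ (Fin d) → ℝ}
    (hχ : IsDyadicCutoff χ) (u v : Distribution d) (j : ℕ) :
    dyadicBlock χ (u + v) j = dyadicBlock χ u j + dyadicBlock χ v j := by
  funext x
  simp only [Pi.add_apply, hχ.dyadicBlock_eq_sum, fourierCoeff_add, add_mul, mul_add,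
    Finset.sum_add_distrib]

theorem IsDyadicCutoff.dyadicBlock_smul {χ : EuclideanSpace ℝ (Fin d) → ℝ}
    (hχ : IsDyadicCutoff χ) (c : ℝ) (u : Distribution d) (j : ℕ) :
    dyadicBlock χ (c • u) j = c • dyadicBlock χ u j := by
  funext x
  simp only [Pi.smul_apply, hχ.dyadicBlock_eq_sum, fourierCoeff_smul, Finset.smul_sum,
    Complex.real_smul]
  exact Finset.sum_congr rfl fun k _ => by ring

theorem IsDyadicCutoff.continuous_dyadicBlock {χ : EuclideanSpace ℝ (Fin d) → ℝ}
    (hχ : IsDyadicCutoff χ) (u : Distribution d) (j : ℕ) : Continuous (dyadicBlock χ u j) := by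
  simp_rw [funext fun x => hχ.dyadicBlock_eq_sum u j x]
  fun_prop

theorem IsDyadicCutoff.hasDiracBlockGrowth_zero {χ : EuclideanSpace ℝ (Fin d) → ℝ}
    (hχ : IsDyadicCutoff χ) (p : ℝ≥0∞) : HasDiracBlockGrowth χ p (0 : Distribution d) := by
  refine ⟨0, fun j => ?_⟩
  have : dyadicBlock χ (0 : Distribution d) j = 0 := by
    funext x
    simp [hχ.dyadicBlock_eq_sum, fourierCoeff_zero]
  simp [this]

theorem HasDiracBlockGrowth.add {χ : EuclideanSpace ℝ (Fin d) → ℝ} {p : ℝ≥0∞}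
    {u v : Distribution d} (hu : HasDiracBlockGrowth χ p u) (hv : HasDiracBlockGrowth χ p v)
    (hχ : IsDyadicCutoff χ) : HasDiracBlockGrowth χ p (u + v) := by
  obtain ⟨A, hA⟩ := hu
  obtain ⟨B, hB⟩ := hv
  -- For `p < 1` the triangle inequality holds only up to the constant `LpAddConst p`.
  refine hasDiracBlockGrowth_of_ne_top (C := ENNReal.LpAddConst p * (A + B))
    (ENNReal.mul_ne_top (ENNReal.LpAddConst_lt_top p).ne (by simp)) fun j => ?_
  rw [hχ.dyadicBlock_add, mul_assoc, add_mul]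
  refine (eLpNorm_add_le' (hχ.continuous_dyadicBlock u j).aestronglyMeasurable
    (hχ.continuous_dyadicBlock v j).aestronglyMeasurable p).trans ?_
  gcongr
  exacts [hA j, hB j]

theorem HasDiracBlockGrowth.smul {χ : EuclideanSpace ℝ (Fin d) → ℝ} {p : ℝ≥0∞}
    {u : Distribution d} (hu : HasDiracBlockGrowth χ p u) (hχ : IsDyadicCutoff χ) (c : ℝ) :
    HasDiracBlockGrowth χ p (c • u) := by
  obtain ⟨A, hA⟩ := hu
  refine hasDiracBlockGrowth_of_ne_top (C := ‖c‖ₑ * A)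
    (ENNReal.mul_ne_top enorm_ne_top (by simp)) fun j => ?_
  rw [hχ.dyadicBlock_smul, eLpNorm_const_smul, mul_assoc]
  gcongr
  exact hA j

/-! ### Dirac masses -/

/-- Evaluation at `r`, as a linear form. -/
def evalLinearMap (r : UnitAddTorus (Fin d)) : TestFunction d →ₗ[ℝ] ℝ where
  toFun φ := φ r
  map_add' _ _ := rfl
  map_smul' _ _ := rfl

theorem continuous_evalLinearMap (r : UnitAddTorus (Fin d)) : Continuous (evalLinearMap r) := by
  refine WithSeminorms.continuous_normedSpace_rng ℝ (withSeminorms_derivSeminorm d) _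
    ⟨{0}, 1, fun φ => ?_⟩
  obtain ⟨x, rfl⟩ : ∃ x, proj x = r :=
    ⟨fun i => (QuotientAddGroup.mk_surjective (r i)).choose,
      funext fun i => (QuotientAddGroup.mk_surjective (r i)).choose_spec⟩
  simp only [Seminorm.comp_apply, coe_normSeminorm, Finset.sup_singleton, one_smul]
  refine le_trans (le_of_eq ?_) (le_ciSup (φ.bddAbove 0) x)
  rw [norm_iteratedFDeriv_zero]
  rfl

/-- The Dirac mass at `r`. -/
def dirac (r : UnitAddTorus (Fin d)) : Distribution d :=
  ⟨evalLinearMap r, continuous_evalLinearMap r⟩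

@[simp]
theorem dirac_apply (r : UnitAddTorus (Fin d)) (φ : TestFunction d) : dirac r φ = φ r := rfl

theorem fourierCoeff_dirac (r : UnitAddTorus (Fin d)) (k : Fin d → ℤ) :
    fourierCoeff (dirac r) k = UnitAddTorus.mFourier (-k) r := by
  rw [fourierCoeff, dirac_apply, dirac_apply, mul_comm]
  exact Complex.re_add_im _

theorem mFourier_neg_mul_mFourier (k : Fin d → ℤ) (r x : UnitAddTorus (Fin d)) :
    UnitAddTorus.mFourier (-k) r * UnitAddTorus.mFourier k x = UnitAddTorus.mFourier k (x - r) := by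
  simp only [UnitAddTorus.mFourier, ContinuousMap.coe_mk, ← Finset.prod_mul_distrib]
  refine Finset.prod_congr rfl fun i _ => ?_
  rw [fourier_apply, fourier_apply, fourier_apply, ← Circle.coe_mul, ← AddCircle.toCircle_add,
    Pi.neg_apply, Pi.sub_apply, neg_smul, smul_sub, neg_add_eq_sub]

theorem dyadicBlock_dirac (χ : EuclideanSpace ℝ (Fin d) → ℝ) (r : UnitAddTorus (Fin d)) (j : ℕ) :
    dyadicBlock χ (dirac r) j = dyadicKernel (blockProfile χ j) j ∘ fun x => x - r := by
  funext x
  simp only [dyadicBlock_eq_tsum, fourierCoeff_dirac, mFourier_neg_mul_mFourier, dyadicKernel,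
    Function.comp_apply]

theorem continuous_dyadicKernel {g : EuclideanSpace ℝ (Fin d) → ℝ}
    (hg0 : ∀ ξ, 2 ≤ ‖ξ‖ → g ξ = 0) (n : ℕ) : Continuous (dyadicKernel g n) := by
  simp_rw [funext fun x => show dyadicKernel g n x = _ from
    (supportedInCube_dyadicSample hg0 n).tsum_eq _]
  fun_prop

theorem IsDyadicCutoff.hasDiracBlockGrowth_dirac {χ : EuclideanSpace ℝ (Fin d) → ℝ}
    (hχ : IsDyadicCutoff χ) {p : ℝ≥0∞} (hp : 0 < p) (r : UnitAddTorus (Fin d)) :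
    HasDiracBlockGrowth χ p (dirac r) := by
  -- All pieces with `j ≥ 1` share one profile, so the estimates for profiles `0` and `1` give a
  -- constant uniform in `j`.
  obtain ⟨A, hA, hA'⟩ := exists_eLpNorm_dyadicKernel_le (hχ.blockProfile_contDiff 0)
    (hχ.blockProfile_eq_zero 0) hp
  obtain ⟨B, hB, hB'⟩ := exists_eLpNorm_dyadicKernel_le (hχ.blockProfile_contDiff 1)
    (hχ.blockProfile_eq_zero 1) hp
  refine hasDiracBlockGrowth_of_ne_top (C := max A B) (by simp [hA, hB]) fun j => ?_
  rw [dyadicBlock_dirac, eLpNorm_comp_measurePreserving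
    (continuous_dyadicKernel (hχ.blockProfile_eq_zero j) j).aestronglyMeasurable
    (measurePreserving_sub_right volume r)]
  cases j with
  | zero => exact (hA' 0).trans (mul_le_mul_left (le_max_left _ _) _)
  | succ j => exact (hB' (j + 1)).trans (mul_le_mul_left (le_max_right _ _) _)

/-! ### Measurability -/

theorem measurable_eval (φ : TestFunction d) : Measurable fun u : Distribution d => u φ := by
  intro s hs
  refine MeasurableSpace.measurableSet_generateFrom
    ⟨1, fun _ => φ, (fun v : Fin 1 → ℝ => v 0) ⁻¹' s, measurable_pi_apply 0 hs, rfl⟩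

/-- Identifies the cylindrical σ-field with the trace of the product one, so that laws can be
compared through their finite-dimensional marginals. -/
theorem cylindrical_eq_comap : (inferInstance : MeasurableSpace (Distribution d)) =
    MeasurableSpace.comap (fun u φ => u φ) (MeasurableSpace.pi (X := fun _ : TestFunction d => ℝ)) := by
  refine le_antisymm (MeasurableSpace.generateFrom_le ?_) ?_
  · rintro _ ⟨N, φ, B, hB, rfl⟩
    exact ⟨(fun f n => f (φ n)) ⁻¹' B,
      (measurable_pi_lambda _ fun n => measurable_pi_apply (φ n)) hB, rfl⟩
  · exact (measurable_pi_lambda (fun (u : Distribution d) φ => u φ) measurable_eval).comap_le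

theorem measurable_distribution_iff {α : Type*} [MeasurableSpace α] {f : α → Distribution d} :
    Measurable f ↔ ∀ φ, Measurable fun a => f a φ := by
  refine ⟨fun hf φ => (measurable_eval φ).comp hf, fun hf => ?_⟩
  have h : Measurable[_, MeasurableSpace.comap (fun u φ => u φ)
      (MeasurableSpace.pi (X := fun _ : TestFunction d => ℝ))] f :=
    measurable_comap_iff.2 (measurable_pi_lambda _ hf)
  rwa [← cylindrical_eq_comap] at h

theorem measurable_fourierCoeff (k : Fin d → ℤ) :
    Measurable fun u : Distribution d => fourierCoeff u k := by
  have h1 := measurable_eval (cosTest (-k))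
  have h2 := measurable_eval (sinTest (-k))
  exact (Complex.measurable_ofReal.comp h1).add
    ((Complex.measurable_ofReal.comp h2).const_mul Complex.I)

/-- For finite `p` the norm is a power of an integral of a jointly measurable function, so it is
measurable in `u`. -/
theorem IsDyadicCutoff.measurable_eLpNorm_dyadicBlock {χ : EuclideanSpace ℝ (Fin d) → ℝ}
    (hχ : IsDyadicCutoff χ) {p : ℝ≥0∞} (hp : p ≠ ∞) (j : ℕ) :
    Measurable fun u => eLpNorm (dyadicBlock χ u j) p volume := by
  rcases eq_or_ne p 0 with rfl | hp0
  · simp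
  simp only [eLpNorm_eq_lintegral_rpow_enorm_toReal hp0 hp]
  have h : Measurable fun y : Distribution d × UnitAddTorus (Fin d) => dyadicBlock χ y.1 j y.2 := by
    simp only [hχ.dyadicBlock_eq_sum]
    refine Finset.measurable_sum _ fun k _ => Measurable.mul measurable_const (Measurable.mul
      ((measurable_fourierCoeff k).comp measurable_fst) ?_)
    exact (UnitAddTorus.mFourier k).continuous.measurable.comp measurable_snd
  exact (Measurable.lintegral_prod_right' (h.enorm.pow_const _)).pow_const _

theorem IsDyadicCutoff.measurableSet_hasDiracBlockGrowth {χ : EuclideanSpace ℝ (Fin d) → ℝ}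
    (hχ : IsDyadicCutoff χ) {p : ℝ≥0∞} (hp : p ≠ ∞) :
    MeasurableSet {u | HasDiracBlockGrowth χ p u} := by
  simp only [HasDiracBlockGrowth, Set.ofPred_exists, Set.ofPred_forall]
  exact MeasurableSet.iUnion fun C => MeasurableSet.iInter fun j =>
    measurableSet_le (hχ.measurable_eLpNorm_dyadicBlock hp j) measurable_const

/-! ### Bounded Fourier coefficients, a measurable substitute at `p = ∞` -/

/-- The Fourier coefficients of `u` are bounded. -/
def HasBoundedCoeff (u : Distribution d) : Prop :=
  ∃ C : ℕ, ∀ k, ‖fourierCoeff u k‖ ≤ C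

theorem measurableSet_hasBoundedCoeff : MeasurableSet {u : Distribution d | HasBoundedCoeff u} := by
  simp only [HasBoundedCoeff, Set.ofPred_exists, Set.ofPred_forall]
  exact MeasurableSet.iUnion fun C => MeasurableSet.iInter fun k =>
    measurableSet_le (measurable_fourierCoeff k).norm measurable_const

theorem hasBoundedCoeff_sum_smul_dirac {n : ℕ} (y : Fin n → UnitAddTorus (Fin d) × ℝ) :
    HasBoundedCoeff (∑ i, (y i).2 • dirac (y i).1) := by
  obtain ⟨C, hC⟩ := exists_nat_ge (∑ i, |(y i).2|)
  refine ⟨C, fun k => le_trans ?_ hC⟩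
  have : ∀ s : Finset (Fin n), ‖fourierCoeff (∑ i ∈ s, (y i).2 • dirac (y i).1) k‖ ≤
      ∑ i ∈ s, |(y i).2| := by
    intro s
    induction s using Finset.cons_induction with
    | empty => simp [fourierCoeff_zero]
    | cons i s hi ih =>
      rw [Finset.sum_cons, Finset.sum_cons, fourierCoeff_add, fourierCoeff_smul, fourierCoeff_dirac]
      refine (norm_add_le _ _).trans (add_le_add (le_of_eq ?_) ih)
      rw [norm_mul, norm_mFourier_apply, mul_one, Complex.norm_real, Real.norm_eq_abs]
  exact this Finset.univ

/-- At `p = ∞` no cancellation is needed: the block has at most `(5·2^j)^d` bounded terms, and the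
rate is exactly `2^{jd}`. -/
theorem HasBoundedCoeff.hasDiracBlockGrowth_top {χ : EuclideanSpace ℝ (Fin d) → ℝ}
    (hχ : IsDyadicCutoff χ) {u : Distribution d} (hu : HasBoundedCoeff u) :
    HasDiracBlockGrowth χ ∞ u := by
  obtain ⟨C, hC⟩ := hu
  obtain ⟨A, hA⟩ := exists_norm_iteratedFDeriv_le (hχ.blockProfile_contDiff 0)
    (hχ.blockProfile_eq_zero 0) 0
  obtain ⟨B, hB⟩ := exists_norm_iteratedFDeriv_le (hχ.blockProfile_contDiff 1)
    (hχ.blockProfile_eq_zero 1) 0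
  have hsample : ∀ j k, ‖dyadicSample (blockProfile χ j) j k‖ ≤ max A B := by
    intro j k
    rw [dyadicSample, Complex.norm_real, ← norm_iteratedFDeriv_zero (𝕜 := ℝ)]
    cases j with
    | zero => exact (hA _).trans (le_max_left _ _)
    | succ j => exact (hB _).trans (le_max_right _ _)
  have hmax : 0 ≤ max A B := (norm_nonneg _).trans (hsample 0 0)
  refine hasDiracBlockGrowth_of_ne_top (C := ENNReal.ofReal (5 ^ d * (max A B * C)))
    ENNReal.ofReal_ne_top fun j => ?_
  have hx : ∀ x, ‖dyadicBlock χ u j x‖ ≤ 5 ^ d * (max A B * C) * 2 ^ (j * d) := by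
    intro x
    rw [dyadicBlock_eq_tsum]
    refine ((hχ.supportedInCube j).norm_tsum_le (hsample j) (B := C) fun k => ?_).trans ?_
    · rw [norm_mul, norm_mFourier_apply, mul_one]
      exact hC k
    · rw [mul_right_comm, pow_mul, ← mul_pow]
      have h1 : (1 : ℝ) ≤ 2 ^ j := one_le_pow₀ (by norm_num)
      gcongr
      push_cast
      linarith
  refine (eLpNorm_le_of_ae_bound (Filter.Eventually.of_forall hx)).trans (le_of_eq ?_)
  rw [blockRate, ← ENNReal.ofReal_mul (by positivity)]
  simp only [ENNReal.toReal_top, inv_zero, ENNReal.rpow_zero, one_mul, ENNReal.inv_top,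
    ENNReal.toReal_zero, sub_zero, mul_one]
  congr 2
  rw [← Nat.cast_mul, Real.rpow_natCast]

theorem IsDyadicCutoff.hasDiracBlockGrowth_sum_smul_dirac {χ : EuclideanSpace ℝ (Fin d) → ℝ}
    (hχ : IsDyadicCutoff χ) {p : ℝ≥0∞} (hp : 0 < p) {n : ℕ}
    (y : Fin n → UnitAddTorus (Fin d) × ℝ) :
    HasDiracBlockGrowth χ p (∑ i, (y i).2 • dirac (y i).1) :=
  Finset.sum_induction _ (HasDiracBlockGrowth χ p) (fun _ _ hu hv => hu.add hv hχ)
    (hχ.hasDiracBlockGrowth_zero p) fun _ _ => (hχ.hasDiracBlockGrowth_dirac hp _).smul hχ _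

/-- The growth of the dyadic blocks follows from a measurable property of all finite combinations
of Dirac masses. -/
theorem IsDyadicCutoff.exists_measurableSet_hasDiracBlockGrowth
    {χ : EuclideanSpace ℝ (Fin d) → ℝ} (hχ : IsDyadicCutoff χ) {p : ℝ≥0∞} (hp : 0 < p) :
    ∃ S : Set (Distribution d), MeasurableSet S ∧ (∀ u ∈ S, HasDiracBlockGrowth χ p u) ∧
      ∀ (n : ℕ) (y : Fin n → UnitAddTorus (Fin d) × ℝ), ∑ i, (y i).2 • dirac (y i).1 ∈ S := by
  -- At `p = ∞` the block norm is an essential supremum, to which the integral argument for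
  -- measurability does not apply; boundedness of the coefficients is a countable condition that
  -- implies the growth.
  rcases eq_or_ne p ∞ with rfl | hp'
  · exact ⟨{u | HasBoundedCoeff u}, measurableSet_hasBoundedCoeff,
      fun u hu => HasBoundedCoeff.hasDiracBlockGrowth_top hχ hu,
      fun n y => hasBoundedCoeff_sum_smul_dirac y⟩
  · exact ⟨{u | HasDiracBlockGrowth χ p u}, hχ.measurableSet_hasDiracBlockGrowth hp',
      fun u hu => hu, fun n y => hχ.hasDiracBlockGrowth_sum_smul_dirac hp y⟩

/-! ### The law of a generalized periodic process is determined by its characteristic functional -/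

open scoped Classical in
-- By linearity of `u`, a linear form of finitely many pairings is a single pairing with a combined
-- test function; this is the Cramér–Wold reduction.
theorem charFunDual_map_eval (μ : Measure (Distribution d)) (I : Finset (TestFunction d))
    (L : StrongDual ℝ (I → ℝ)) :
    charFunDual (μ.map fun u (φ : I) => u φ) L =
      charFunctional μ (∑ φ : I, L (Pi.single φ 1) • (φ : TestFunction d)) := by
  have hm : Measurable fun (u : Distribution d) (φ : I) => u φ :=
    measurable_pi_lambda _ fun φ => measurable_eval (φ : TestFunction d)
  rw [charFunDual_apply, charFunctional, integral_map hm.aemeasurable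
    (by fun_prop)]
  refine integral_congr_ae (Filter.Eventually.of_forall fun u => ?_)
  simp only [map_sum, map_smul, smul_eq_mul]
  rw [mul_comm]
  congr 3
  have := LinearMap.pi_apply_eq_sum_univ (L : (I → ℝ) →ₗ[ℝ] ℝ) fun φ => u φ
  refine this.trans (Finset.sum_congr rfl fun φ _ => ?_)
  rw [smul_eq_mul, mul_comm]
  refine congrArg (· * u φ) (congrArg L (funext fun ψ => ?_))
  simp [Pi.single_apply, eq_comm]

/-- The characteristic functional fixes all finite-dimensional marginals, and a finite measure on
the product space is the unique projective limit of its marginals. -/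
theorem ext_of_charFunctional {μ ν : Measure (Distribution d)} [IsFiniteMeasure μ]
    [IsFiniteMeasure ν] (h : ∀ φ, charFunctional μ φ = charFunctional ν φ) : μ = ν := by
  have hev : Measurable fun (u : Distribution d) (φ : TestFunction d) => u φ :=
    measurable_pi_lambda _ measurable_eval
  have hmap : ∀ (ρ : Measure (Distribution d)) (I : Finset (TestFunction d)),
      (ρ.map fun u φ => u φ).map I.restrict = ρ.map fun u (φ : I) => u φ := fun ρ I =>
    Measure.map_map (Finset.measurable_restrict I) hev
  have hfin : ∀ I : Finset (TestFunction d),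
      (μ.map fun u (φ : I) => u φ) = ν.map fun u (φ : I) => u φ := fun I =>
    Measure.ext_of_charFunDual (funext fun L => by simp only [charFunDual_map_eval, h])
  have hpi : (μ.map fun u φ => u φ) = ν.map fun u φ => u φ :=
    IsProjectiveLimit.unique (P := fun I : Finset (TestFunction d) =>
      μ.map fun u (φ : I) => u φ) (fun I => hmap μ I) fun I => (hmap ν I).trans (hfin I).symm
  ext s hs
  obtain ⟨t, ht, rfl⟩ : MeasurableSet[MeasurableSpace.comap (fun u φ => u φ)
      (MeasurableSpace.pi (X := fun _ : TestFunction d => ℝ))] s := by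
    rw [← cylindrical_eq_comap]
    exact hs
  rw [← Measure.map_apply hev ht, hpi, Measure.map_apply hev ht]

/-! ### The law of a compound Poisson noise -/

theorem TestFunction.continuous (φ : TestFunction d) : Continuous φ := by
  have hq : IsOpenQuotientMap (proj (d := d)) :=
    IsOpenQuotientMap.piMap fun _ => QuotientAddGroup.isOpenQuotientMap_mk
  exact hq.isQuotientMap.continuous_iff.2 φ.contDiff_lift.continuous

/-- The combination `∑ t_i δ_{r_i}` of Dirac masses. -/
noncomputable def pointSum (n : ℕ) (y : Fin n → UnitAddTorus (Fin d) × ℝ) : Distribution d :=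
  ∑ i, (y i).2 • dirac (y i).1

theorem pointSum_apply (n : ℕ) (y : Fin n → UnitAddTorus (Fin d) × ℝ) (φ : TestFunction d) :
    pointSum n y φ = ∑ i, (y i).2 * φ (y i).1 := by
  simp [pointSum]

theorem measurable_pointSum (n : ℕ) : Measurable (pointSum (d := d) n) := by
  refine measurable_distribution_iff.2 fun φ => ?_
  simp only [pointSum_apply]
  have := φ.continuous.measurable
  fun_prop

/-- The law of `∑_{i < N} t_i δ_{r_i}`, where `N` has the Poisson law of parameter `c` and the
`(r_i, t_i)` are independent of law `λ ⊗ P`. -/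
noncomputable def compoundPoissonLaw (d : ℕ) (c : ℝ) (P : Measure ℝ) :
    Measure (Distribution d) :=
  Measure.sum fun n : ℕ => ENNReal.ofReal (Real.exp (-c) * (c ^ n / n.factorial)) •
    (Measure.pi fun _ : Fin n => (volume : Measure (UnitAddTorus (Fin d))).prod P).map (pointSum n)

theorem isProbabilityMeasure_compoundPoissonLaw {c : ℝ} (hc : 0 < c) (P : Measure ℝ)
    [IsProbabilityMeasure P] : IsProbabilityMeasure (compoundPoissonLaw d c P) := by
  constructor
  have hprob : ∀ n : ℕ, IsProbabilityMeasure ((Measure.pi fun _ : Fin n =>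
      (volume : Measure (UnitAddTorus (Fin d))).prod P).map (pointSum n)) := fun n =>
    Measure.isProbabilityMeasure_map (measurable_pointSum n).aemeasurable
  have hsum : HasSum (fun n : ℕ => Real.exp (-c) * (c ^ n / n.factorial)) 1 := by
    have := (NormedSpace.expSeries_div_hasSum_exp c).mul_left (Real.exp (-c))
    rwa [← Real.exp_eq_exp_ℝ, ← Real.exp_add, neg_add_cancel, Real.exp_zero] at this
  simp only [compoundPoissonLaw, Measure.sum_apply _ MeasurableSet.univ, Measure.smul_apply,
    measure_univ, smul_eq_mul, mul_one]
  rw [← ENNReal.ofReal_tsum_of_nonneg (fun n => by positivity) hsum.summable, hsum.tsum_eq,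
    ENNReal.ofReal_one]

/-- The exponential of the sum factors over the `n` independent, identically distributed pairs. -/
theorem charFunctional_map_pointSum (P : Measure ℝ) [IsProbabilityMeasure P] (n : ℕ)
    (φ : TestFunction d) :
    charFunctional ((Measure.pi fun _ : Fin n =>
      (volume : Measure (UnitAddTorus (Fin d))).prod P).map (pointSum n)) φ =
    (∫ y, Complex.exp (Complex.I * y.2 * (φ y.1 : ℂ))
      ∂((volume : Measure (UnitAddTorus (Fin d))).prod P)) ^ n := by
  have hm : Measurable fun u : Distribution d => Complex.exp (Complex.I * (u φ : ℂ)) :=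
    ((Complex.measurable_ofReal.comp (measurable_eval φ)).const_mul Complex.I).cexp
  rw [charFunctional, integral_map (measurable_pointSum n).aemeasurable hm.aestronglyMeasurable]
  have := integral_fintype_prod_eq_pow (ι := Fin n) (𝕜 := ℂ)
    (μ := (volume : Measure (UnitAddTorus (Fin d))).prod P) fun y => Complex.exp (Complex.I * y.2 * (φ y.1 : ℂ))
  rw [Fintype.card_fin] at this
  rw [← this]
  refine integral_congr_ae (Filter.Eventually.of_forall fun y => ?_)
  simp only [pointSum_apply]
  rw [← Complex.exp_sum]
  congr 1
  push_cast
  rw [Finset.mul_sum]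
  exact Finset.sum_congr rfl fun i _ => by ring

theorem norm_exp_I_mul_ofReal_mul_ofReal (s t : ℝ) :
    ‖Complex.exp (Complex.I * s * (t : ℂ))‖ = 1 := by
  have : Complex.I * s * (t : ℂ) = ((s * t : ℝ) : ℂ) * Complex.I := by push_cast; ring
  rw [this, Complex.norm_exp_ofReal_mul_I]

/-- With `z` the characteristic functional of a single jump, the mixture gives `∑ e^{-c} c^n z^n /
n! = e^{c(z - 1)}`. -/
theorem charFunctional_compoundPoissonLaw {c : ℝ} (hc : 0 < c) (P : Measure ℝ)
    [IsProbabilityMeasure P] (φ : TestFunction d) :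
    charFunctional (compoundPoissonLaw d c P) φ =
      Complex.exp (c * ∫ r : UnitAddTorus (Fin d), ∫ t : ℝ,
        (Complex.exp (Complex.I * t * (φ r : ℂ)) - 1) ∂P ∂volume) := by
  set ρ := (volume : Measure (UnitAddTorus (Fin d))).prod P with hρ
  set z : ℂ := ∫ y, Complex.exp (Complex.I * y.2 * (φ y.1 : ℂ)) ∂ρ with hz
  have hφ := φ.continuous
  have hcont : Continuous fun y : UnitAddTorus (Fin d) × ℝ =>
      Complex.exp (Complex.I * y.2 * (φ y.1 : ℂ)) := by fun_prop
  have hint : Integrable (fun y : UnitAddTorus (Fin d) × ℝ =>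
      Complex.exp (Complex.I * y.2 * (φ y.1 : ℂ))) ρ :=
    Integrable.of_bound hcont.measurable.aestronglyMeasurable 1
      (Filter.Eventually.of_forall fun y => (norm_exp_I_mul_ofReal_mul_ofReal _ _).le)
  -- Fubini; the constant `-1` integrates to `-1` because `λ ⊗ P` has mass one.
  have hz1 : ∫ r : UnitAddTorus (Fin d), ∫ t : ℝ,
      (Complex.exp (Complex.I * t * (φ r : ℂ)) - 1) ∂P ∂volume = z - 1 := by
    rw [integral_integral (f := fun (r : UnitAddTorus (Fin d)) (t : ℝ) =>
      Complex.exp (Complex.I * t * (φ r : ℂ)) - 1) (hint.sub (integrable_const 1)), ← hρ,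
      integral_sub hint (integrable_const 1)]
    simp [hz]
  have := isProbabilityMeasure_compoundPoissonLaw (d := d) hc P
  have hm : Measurable fun u : Distribution d => Complex.exp (Complex.I * (u φ : ℂ)) :=
    ((Complex.measurable_ofReal.comp (measurable_eval φ)).const_mul Complex.I).cexp
  have hint' : Integrable (fun u : Distribution d => Complex.exp (Complex.I * (u φ : ℂ)))
      (compoundPoissonLaw d c P) :=
    Integrable.of_bound hm.aestronglyMeasurable 1 (Filter.Eventually.of_forall fun u => by simp)
  have hs1 := hasSum_integral_measure hint'
  have hs2 : HasSum (fun n : ℕ => Complex.exp (-c) * ((c * z) ^ n / n.factorial))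
      (Complex.exp (-c) * Complex.exp (c * z)) := by
    rw [Complex.exp_eq_exp_ℂ]
    exact (NormedSpace.expSeries_div_hasSum_exp (c * z : ℂ)).mul_left _
  rw [hz1]
  have hexp : Complex.exp (c * (z - 1)) = Complex.exp (-c) * Complex.exp (c * z) := by
    rw [← Complex.exp_add]; congr 1; ring
  rw [hexp]
  refine hs1.unique (hs2.congr_fun ?_)
  intro n
  rw [integral_smul_measure]
  have h3 := charFunctional_map_pointSum P n φ
  rw [charFunctional] at h3
  rw [h3, ENNReal.toReal_ofReal (by positivity), Complex.real_smul, mul_pow]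
  push_cast
  ring

theorem ae_compoundPoissonLaw {S : Set (Distribution d)} (hS : MeasurableSet S)
    (h : ∀ (n : ℕ) (y : Fin n → UnitAddTorus (Fin d) × ℝ), pointSum n y ∈ S) (c : ℝ)
    (P : Measure ℝ) : ∀ᵐ u ∂compoundPoissonLaw d c P, u ∈ S := by
  rw [compoundPoissonLaw, Measure.ae_sum_iff]
  intro n
  refine Measure.ae_smul_measure ?_ _
  exact (ae_map_iff (p := (· ∈ S)) (measurable_pointSum n).aemeasurable hS).2
    (Filter.Eventually.of_forall (h n))

theorem IsCompoundPoissonNoise.exists_map_eq {Ω : Type*} [MeasurableSpace Ω] {ℙ : Measure Ω}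
    [IsProbabilityMeasure ℙ] {w : Ω → Distribution d} (hw : IsCompoundPoissonNoise ℙ w) :
    ∃ c P, ℙ.map w = compoundPoissonLaw d c P := by
  obtain ⟨hmeas, c, P, hc, hP, -, h⟩ := hw
  have := isProbabilityMeasure_compoundPoissonLaw (d := d) hc P
  have := Measure.isProbabilityMeasure_map (μ := ℙ) hmeas.aemeasurable
  exact ⟨c, P, ext_of_charFunctional fun φ => by
    rw [h, charFunctional_compoundPoissonLaw hc]⟩

end PeriodicNoise

/-! ### Transfer from the law of the noise to its sample paths -/

theorem proposition4p3 (d : ℕ) {Ω : Type*} [MeasurableSpace Ω] (ℙ : Measure Ω)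
    [IsProbabilityMeasure ℙ] (w : Ω → PeriodicNoise.Distribution d)
    (hw : PeriodicNoise.IsCompoundPoissonNoise ℙ w)
    (χ : EuclideanSpace ℝ (Fin d) → ℝ) (hχ : PeriodicNoise.IsDyadicCutoff χ)
    (τ : ℝ) (p q : ℝ≥0∞) (hp : 0 < p) (hq : 0 < q)
    (hτ : τ < (d : ℝ) * ((p⁻¹).toReal - 1)) :
    ∀ᵐ ω ∂ℙ, w ω ∈ PeriodicNoise.besovSpace χ τ p q := by
  obtain ⟨S, hS, hgrowth, hsum⟩ := hχ.exists_measurableSet_hasDiracBlockGrowth hp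
  obtain ⟨c, P, hlaw⟩ := hw.exists_map_eq
  have h := PeriodicNoise.ae_compoundPoissonLaw hS hsum c P
  rw [← hlaw] at h
  filter_upwards [ae_of_ae_map hw.1.aemeasurable h] with ω hω
  exact (hgrowth _ hω).mem_besovSpace hq hτ
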